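/- **Setting.** Let $r>0$, let $L$ be a number of layers and $p_0,p_1,\dots$ be dimensions; let $B_{r}=\{x\in\mathbb R^{p_0}:\|x\|_2\le r\}$. For a set $E$ of edge features let $V_1(\mathcal G_E)$ be the class of pairs $(G,u)$, where $G$ is a finite undirected graph of any size without isolated vertices, with vertex attributes $a_G(v)\in B_r$ and edge features $w_{uv}=w_{vu}\in E$, and $u\in V(G)$. Let $\Theta$ be any parameter set. For each $\theta\in\Theta$ and $1\le t\le L$ let $\phi_t^\theta:\mathbb R^{p_{t-1}}\times\mathbb R^{p_{t-1}}\to\mathbb R^{p_t}$ satisfy $\|\phi_t^\theta(x,y)-\phi_t^\theta(x',y')\|_2\le C_1\|x-x'\|_2+C_2\|y-y'\|_2$ for some $C_1,C_2>0$ (which may depend on $\theta,t$). A family $f_\theta:\mathcal X\to\mathbb R^{d}$ ($\theta\in\Theta$) on a non-empty set is a *finite Lipschitz class* with respect to a pseudo-metric $d_{\mathcal X}$ if every $f_\theta$ is Lipschitz for $d_{\mathcal X}$ and, for every $\varepsilon>0$, $\mathcal X$ is covered by finitely many closed $d_{\mathcal X}$-balls of radius $\varepsilon$ centred in $\mathcal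 X$. **Architectures.** All start from $h^{(0)}_u=a_G(u)$, and $f_\theta(G,u)=h_u^{(L)}$, where, for $1\le t\le L$, - (sum) $h_u^{(t)}=\phi_t^\theta\big(h_u^{(t-1)},\tfrac1{|V(G)|}\sum_{v\in N(u)}w_{uv}h_v^{(t-1)}\big)$; - (mean) $h_u^{(t)}=\phi_t^\theta\big(h_u^{(t-1)},\tfrac1{\deg(u)}\sum_{v\in N(u)}w_{uv}h_v^{(t-1)}\big)$, $\deg(u)=\sum_{v\in N(u)}w_{uv}$; - (max / min) $h_u^{(t)}=\phi_t^\theta\big(h_u^{(t-1)},\max_{v\in N(u)}M_t^\theta(h_v^{(t-1)},w_{uv})\big)$ with coordinatewise maximum, respectively minimum. **Representation spaces.** *Iterated degree measures*: $H_0=B_r$ with $d_0(x,y)=\|x-y\|_2$, and $H_{t+1}=H_t\times\mathcal M_{\le1}(H_t)$ with $d_{t+1}\big((\eta,\mu),(\eta',\mu')\big)=d_t(\eta,\eta')+\mathbf K(\mu,\mu')$, where $\mathcal M_{\le 1}$ denotes Borel measures of mass at most $1$ and $\mathbf K(\mu,\nu)=\sup\{|\int f\,d\mu-\int f\,d\nu|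 : f\ 1\text{-Lipschitz},\ \|f\|_\infty\le1\}$. *Iterated neighborhood sets*: $H^{\max}_0=B_r$ with the Euclidean distance, and $H^{\max}_{t+1}=H^{\max}_t\times\mathrm{Haus}(H^{\max}_t\times E)$, where $\mathrm{Haus}$ is the set of non-empty compact subsets with the Hausdorff metric, $E$ carries the distance of the norm, and products carry the sum of the two distances. **Theorem.** 1. The metric space $H_L$ is compact. Let $E\subset\mathbb R_{>0}$ be compact and non-empty. (a) Let $W$ be any number with $E\subseteq(0,W]$ ($W=1$ if $E\subseteq(0,1]$). Put $\eta_u^{(0)}=a_G(u)$, $\eta_u^{(t+1)}=\big(\eta_u^{(t)},\tfrac1{|V(G)|}\sum_{v\in N(u)}\tfrac{w_{uv}}{W}\delta_{\eta_v^{(t)}}\big)\in H_{t+1}$. The class of normalized-sum MPNNs is a finite Lipschitz class on $V_1(\mathcal G_E)$ with respect to $d_{\mathrm{sum},L}((G,u),(G',u'))=d_L(\eta_u^{(L)},\eta_{u'}^{(L)})$. (b) Put $\overline\eta_u^{(0)}=a_G(u)$, $\overline\eta_u^{(t+1)}=\big(\overline\eta_u^{(t)},\tfrac1{\deg(u)}\sum_{v\in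 N(u)}w_{uv}\delta_{\overline\eta_v^{(t)}}\big)\in H_{t+1}$. The class of mean-aggregation MPNNs is a finite Lipschitz class on $V_1(\mathcal G_E)$ with respect to $d_{\mathrm{mean},L}((G,u),(G',u'))=d_L(\overline\eta_u^{(L)},\overline\eta_{u'}^{(L)})$. 2. Let $E$ be a non-empty compact subset of a real normed space $F$ (for instance $\mathbb R$ or $\mathbb R^{d_e}$), and for $\theta\in\Theta$, $1\le t\le L$ let $M_t^\theta:\mathbb R^{p_{t-1}}\times F\to\mathbb R^{p_{t-1}}$ satisfy $\|M_t^\theta(x,y)-M_t^\theta(x',y')\|_2\le C_1\|x-x'\|_2+C_2\|y-y'\|$ for some $C_1,C_2>0$ (which may depend on $\theta,t$). Then $H_L^{\max}$ is compact. Put $\hat\eta_u^{(0)}=a_G(u)$, $\hat\eta_u^{(t+1)}=\big(\hat\eta_u^{(t)},\{(\hat\eta_v^{(t)},w_{uv}):v\in N(u)\}\big)\in H^{\max}_{t+1}$, and let $d_{\max,L}((G,u),(G',u'))$ be the distance of $\hat\eta_u^{(L)}$ and $\hat\eta_{u'}^{(L)}$ in $H_L^{\max}$. The class of max-aggregation MPNNs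 and the class of min-aggregation MPNNs are finite Lipschitz classes on $V_1(\mathcal G_E)$ with respect to $d_{\max,L}$. -/

import Mathlib

open MeasureTheory
open scoped NNReal ENNReal

noncomputable section

/-! ### Attributed, edge-featured graphs -/

/-- A finite undirected graph without isolated vertices whose vertices carry attributes in the
closed Euclidean ball of radius `r` in `ℝ^{p₀}` and whose edges carry features in `E`. -/
structure AttributedGraph (p₀ : ℕ) (r : ℝ) {F : Type} (E : Set F) where
  V : Type
  [fintypeV : Fintype V]
  graph : SimpleGraph V
  attr : V → Metric.closedBall (0 : EuclideanSpace ℝ (Fin p₀)) r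
  edgeFeature : graph.edgeSet → E
  exists_adj : ∀ u, ∃ v, graph.Adj u v

namespace AttributedGraph

variable {p₀ : ℕ} {r : ℝ} {F : Type} {E : Set F}

attribute [instance] AttributedGraph.fintypeV

/-- The neighborhood `N(u)`, as a type. -/
abbrev Nbr (G : AttributedGraph p₀ r E) (u : G.V) : Type := G.graph.neighborSet u

instance (G : AttributedGraph p₀ r E) (u : G.V) : Fintype (G.Nbr u) := Fintype.ofFinite _

instance (G : AttributedGraph p₀ r E) (u : G.V) : Nonempty (G.Nbr u) :=
  let ⟨v, hv⟩ := G.exists_adj u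
  ⟨⟨v, hv⟩⟩

/-- The feature `w_{uv}` of the edge between `u` and its neighbor `v`. -/
def w (G : AttributedGraph p₀ r E) (u : G.V) (v : G.Nbr u) : E :=
  G.edgeFeature ⟨s(u, v.1), v.2⟩

/-- The weighted degree `∑_{v ∈ N(u)} w_{uv}`. -/
def deg {E : Set ℝ} (G : AttributedGraph p₀ r E) (u : G.V) : ℝ :=
  ∑ v : G.Nbr u, (G.w u v : ℝ)

end AttributedGraph

/-- Pairs `(G, u)` of a graph and one of its vertices. -/
def RootedGraph (p₀ : ℕ) (r : ℝ) {F : Type} (E : Set F) : Type 1 :=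
  Σ G : AttributedGraph p₀ r E, G.V

/-! ### Finite Lipschitz classes -/

/-- The family `f_θ : X → Y` is a finite Lipschitz class with respect to the pseudo-metric `d`:
every `f_θ` has a finite Lipschitz constant, and all covering numbers of `(X, d)` are finite. -/
structure IsFiniteLipschitzClass {X Θ Y : Type*} [PseudoMetricSpace Y]
    (d : PseudoMetricSpace X) (f : Θ → X → Y) : Prop where
  nonempty : Nonempty X
  lipschitz : ∀ θ, ∃ K : ℝ≥0, LipschitzWith K (f θ)
  covering : ∀ ε : ℝ≥0, 0 < ε → Metric.coveringNumber ε (Set.univ : Set X) < ⊤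

/-- `‖f(x,y) - f(x',y')‖ ≤ C₁ ‖x-x'‖ + C₂ ‖y-y'‖` for some constants `C₁, C₂ > 0`. -/
def IsLipschitzInPair {X Y Z : Type*} [NormedAddCommGroup X] [NormedAddCommGroup Y]
    [NormedAddCommGroup Z] (f : X → Y → Z) : Prop :=
  ∃ C₁ C₂ : ℝ, 0 < C₁ ∧ 0 < C₂ ∧ ∀ x x' y y',
    ‖f x y - f x' y'‖ ≤ C₁ * ‖x - x'‖ + C₂ * ‖y - y'‖

/-! ### Message passing neural networks

The index `t` is shifted by one: `φ t` and `M t` are the update and message maps of layer `t + 1`,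
from `ℝ^{p t}` to `ℝ^{p (t + 1)}`. -/

/-- Update maps `ℝ^{p t} × ℝ^{p t} → ℝ^{p (t+1)}`. -/
abbrev UpdateMaps (p : ℕ → ℕ) : Type :=
  ∀ t, EuclideanSpace ℝ (Fin (p t)) → EuclideanSpace ℝ (Fin (p t)) →
    EuclideanSpace ℝ (Fin (p (t + 1)))

/-- Message maps `ℝ^{p t} × F → ℝ^{p t}`. -/
abbrev MessageMaps (p : ℕ → ℕ) (F : Type) : Type :=
  ∀ t, EuclideanSpace ℝ (Fin (p t)) → F → EuclideanSpace ℝ (Fin (p t))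

section MPNN

variable {p : ℕ → ℕ} {r : ℝ}

/-- Normalized-sum aggregation. -/
def sumFeature {E : Set ℝ} (φ : UpdateMaps p) (G : AttributedGraph (p 0) r E) :
    ∀ t, G.V → EuclideanSpace ℝ (Fin (p t))
  | 0, u => (G.attr u : EuclideanSpace ℝ (Fin (p 0)))
  | t + 1, u => φ t (sumFeature φ G t u)
      ((Fintype.card G.V : ℝ)⁻¹ • ∑ v : G.Nbr u, (G.w u v : ℝ) • sumFeature φ G t v)

/-- Mean aggregation. -/
def meanFeature {E : Set ℝ} (φ : UpdateMaps p) (G : AttributedGraph (p 0) r E) :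
    ∀ t, G.V → EuclideanSpace ℝ (Fin (p t))
  | 0, u => (G.attr u : EuclideanSpace ℝ (Fin (p 0)))
  | t + 1, u => φ t (meanFeature φ G t u)
      ((G.deg u)⁻¹ • ∑ v : G.Nbr u, (G.w u v : ℝ) • meanFeature φ G t v)

/-- Coordinatewise maximum of finitely many vectors. -/
def coordMax {ι : Type} [Fintype ι] [Nonempty ι] {n : ℕ} (x : ι → EuclideanSpace ℝ (Fin n)) :
    EuclideanSpace ℝ (Fin n) :=
  WithLp.toLp 2 fun i => Finset.univ.sup' Finset.univ_nonempty fun j => x j i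

/-- Coordinatewise minimum of finitely many vectors. -/
def coordMin {ι : Type} [Fintype ι] [Nonempty ι] {n : ℕ} (x : ι → EuclideanSpace ℝ (Fin n)) :
    EuclideanSpace ℝ (Fin n) :=
  WithLp.toLp 2 fun i => Finset.univ.inf' Finset.univ_nonempty fun j => x j i

/-- Max aggregation. -/
def maxFeature {F : Type} {E : Set F} (φ : UpdateMaps p) (M : MessageMaps p F)
    (G : AttributedGraph (p 0) r E) : ∀ t, G.V → EuclideanSpace ℝ (Fin (p t))
  | 0, u => (G.attr u : EuclideanSpace ℝ (Fin (p 0)))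
  | t + 1, u => φ t (maxFeature φ M G t u)
      (coordMax fun v : G.Nbr u => M t (maxFeature φ M G t v) (G.w u v))

/-- Min aggregation. -/
def minFeature {F : Type} {E : Set F} (φ : UpdateMaps p) (M : MessageMaps p F)
    (G : AttributedGraph (p 0) r E) : ∀ t, G.V → EuclideanSpace ℝ (Fin (p t))
  | 0, u => (G.attr u : EuclideanSpace ℝ (Fin (p 0)))
  | t + 1, u => φ t (minFeature φ M G t u)
      (coordMin fun v : G.Nbr u => M t (minFeature φ M G t v) (G.w u v))

end MPNN

/-! ### Sub-probability measures with the Kantorovich–Rubinshtein distance -/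

/-- `M_{≤ 1}(X)`: measures of total mass at most one. -/
def SubProb (X : Type) [MeasurableSpace X] : Type := {μ : Measure X // μ Set.univ ≤ 1}

/-- Test functions of the Kantorovich–Rubinshtein distance: `1`-Lipschitz and bounded by `1`. -/
def KRTest (X : Type) [MetricSpace X] : Type :=
  {f : X → ℝ // (∀ x x', |f x - f x'| ≤ dist x x') ∧ ∀ x, |f x| ≤ 1}

namespace SubProb

variable {X : Type} [MetricSpace X] [MeasurableSpace X]

instance (μ : SubProb X) : IsFiniteMeasure μ.1 := ⟨μ.2.trans_lt ENNReal.one_lt_top⟩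

/-- The Kantorovich–Rubinshtein distance. -/
def krDist (μ ν : SubProb X) : ℝ := ⨆ f : KRTest X, |∫ x, f.1 x ∂μ.1 - ∫ x, f.1 x ∂ν.1|

lemma abs_integral_le_one (μ : SubProb X) (f : KRTest X) : |∫ x, f.1 x ∂μ.1| ≤ 1 := by
  have h := norm_integral_le_of_norm_le_const (μ := μ.1) (f := f.1) (C := 1)
    (Filter.Eventually.of_forall fun x => by simpa using f.2.2 x)
  have h1 : μ.1.real Set.univ ≤ 1 := by
    simpa [Measure.real] using ENNReal.toReal_mono ENNReal.one_ne_top μ.2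
  rw [Real.norm_eq_abs] at h
  linarith

lemma bddAbove_kr (μ ν : SubProb X) :
    BddAbove (Set.range fun f : KRTest X => |∫ x, f.1 x ∂μ.1 - ∫ x, f.1 x ∂ν.1|) := by
  refine ⟨2, ?_⟩
  rintro _ ⟨f, rfl⟩
  have h1 := abs_le.1 (abs_integral_le_one μ f)
  have h2 := abs_le.1 (abs_integral_le_one ν f)
  exact abs_le.2 ⟨by linarith, by linarith⟩

lemma le_krDist (μ ν : SubProb X) (f : KRTest X) :
    |∫ x, f.1 x ∂μ.1 - ∫ x, f.1 x ∂ν.1| ≤ krDist μ ν :=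
  le_ciSup (bddAbove_kr μ ν) f

instance : Nonempty (KRTest X) := ⟨⟨fun _ => 0, by simp, by simp⟩⟩

lemma krDist_triangle (μ ν ρ : SubProb X) : krDist μ ρ ≤ krDist μ ν + krDist ν ρ :=
  ciSup_le fun f => (abs_sub_le _ (∫ x, f.1 x ∂ν.1) _).trans
    (add_le_add (le_krDist μ ν f) (le_krDist ν ρ f))

lemma eq_of_krDist_eq_zero [BorelSpace X] (μ ν : SubProb X) (h : krDist μ ν = 0) : μ = ν := by
  have key : ∀ f : KRTest X, ∫ x, f.1 x ∂μ.1 = ∫ x, f.1 x ∂ν.1 := fun f =>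
    sub_eq_zero.1 (abs_nonpos_iff.1 ((le_krDist μ ν f).trans h.le))
  have thick : ∀ (δ : ℝ) (hδ : 0 < δ) (S : Set X),
      ∫ x, (thickenedIndicator hδ S x : ℝ) ∂μ.1 = ∫ x, (thickenedIndicator hδ S x : ℝ) ∂ν.1 := by
    intro δ hδ S
    have hl := lipschitzWith_thickenedIndicator hδ S
    have hc : 0 < min δ 1 := lt_min hδ one_pos
    let f : KRTest X := ⟨fun x => min δ 1 * (thickenedIndicator hδ S x : ℝ), by
      intro x x'
      have h1 := hl.dist_le_mul x x'
      rw [NNReal.dist_eq] at h1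
      rw [← mul_sub, abs_mul, abs_of_pos hc]
      have h2 : ((δ.toNNReal)⁻¹ : ℝ≥0) = (δ⁻¹ : ℝ) := by
        simp [Real.coe_toNNReal δ hδ.le]
      rw [h2] at h1
      calc min δ 1 * |(thickenedIndicator hδ S x : ℝ) - thickenedIndicator hδ S x'|
          ≤ δ * (δ⁻¹ * dist x x') :=
            mul_le_mul (min_le_left _ _) h1 (abs_nonneg _) hδ.le
        _ = dist x x' := by field_simp, by
      intro x
      have h1 : (thickenedIndicator hδ S x : ℝ) ≤ 1 := by
        exact_mod_cast thickenedIndicator_le_one hδ S x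
      have h0 : (0 : ℝ) ≤ thickenedIndicator hδ S x := NNReal.coe_nonneg _
      rw [abs_of_nonneg (by positivity)]
      exact mul_le_one₀ (min_le_right _ _) h0 h1⟩
    have := key f
    simp only [f, integral_const_mul] at this
    exact mul_left_cancel₀ hc.ne' this
  have closed : ∀ S : Set X, IsClosed S → μ.1 S = ν.1 S := by
    intro S hS
    have hδ : ∀ n : ℕ, (0 : ℝ) < 1 / ((n : ℝ) + 1) := fun n => by positivity
    have h1 := tendsto_integral_thickenedIndicator_of_isClosed μ.1 hS hδ
      tendsto_one_div_add_atTop_nhds_zero_nat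
    have h2 := tendsto_integral_thickenedIndicator_of_isClosed ν.1 hS hδ
      tendsto_one_div_add_atTop_nhds_zero_nat
    simp only [fun n => thick _ (hδ n) S] at h1
    exact (measureReal_eq_measureReal_iff).1 (tendsto_nhds_unique h1 h2)
  apply Subtype.ext
  refine ext_of_generate_finite _ ?_ isPiSystem_isClosed (fun S hS => closed S hS)
    (closed _ isClosed_univ)
  rw [BorelSpace.measurable_eq (α := X), borel_eq_generateFrom_isClosed]

instance [BorelSpace X] : MetricSpace (SubProb X) where
  dist := krDist
  dist_self μ := by simp [krDist]
  dist_comm μ ν := by simp only [krDist, abs_sub_comm]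
  dist_triangle := krDist_triangle
  eq_of_dist_eq_zero {μ ν} h := eq_of_krDist_eq_zero μ ν h

end SubProb

/-! ### The recursive representation spaces -/

/-- A type bundled with a metric. -/
structure BundledMetric : Type 1 where
  carrier : Type
  [metric : MetricSpace carrier]

namespace BundledMetric

instance : CoeSort BundledMetric Type := ⟨carrier⟩

instance (X : BundledMetric) : MetricSpace X := X.metric

/-- Every bundled metric space carries its Borel `σ`-algebra. -/
instance (X : BundledMetric) : MeasurableSpace X := borel X

instance (X : BundledMetric) : BorelSpace X := ⟨rfl⟩

end BundledMetric

/-- Iterated degree measures `H_t`: `H_0` is the ball and `H_{t+1} = H_t × M_{≤ 1}(H_t)`, with the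
sum (`ℓ¹`) of the two distances. -/
def IDM (p₀ : ℕ) (r : ℝ) : ℕ → BundledMetric
  | 0 => ⟨Metric.closedBall (0 : EuclideanSpace ℝ (Fin p₀)) r⟩
  | t + 1 => ⟨WithLp 1 (IDM p₀ r t × SubProb (IDM p₀ r t))⟩

/-- Iterated neighborhood sets: `H_0` is the ball and `H_{t+1} = H_t × Haus(H_t × E)`, where
`Haus` is the space of nonempty compact subsets with the Hausdorff distance, and products carry
the sum (`ℓ¹`) of the two distances. -/
def INS (p₀ : ℕ) (r : ℝ) {F : Type} [NormedAddCommGroup F] (E : Set F) : ℕ → BundledMetric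
  | 0 => ⟨Metric.closedBall (0 : EuclideanSpace ℝ (Fin p₀)) r⟩
  | t + 1 => ⟨WithLp 1 (INS p₀ r E t ×
      TopologicalSpace.NonemptyCompacts (WithLp 1 (INS p₀ r E t × E)))⟩

/-! ### Induced representations and pseudo-metrics -/

/-- `∑_j c_j δ_{x_j}` for nonnegative `c_j` with `∑_j c_j ≤ 1`. -/
def SubProb.weightedDirac {X : Type} [MeasurableSpace X] {ι : Type} [Fintype ι] (c : ι → ℝ)
    (hc : ∀ j, 0 ≤ c j) (hsum : ∑ j, c j ≤ 1) (x : ι → X) : SubProb X :=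
  ⟨∑ j, ENNReal.ofReal (c j) • Measure.dirac (x j), by
    simp only [Measure.coe_finsetSum, Finset.sum_apply, Measure.smul_apply, measure_univ,
      smul_eq_mul, mul_one]
    rw [← ENNReal.ofReal_sum_of_nonneg fun j _ => hc j]
    exact ENNReal.ofReal_le_one.2 hsum⟩

section Induced

variable {p₀ : ℕ} {r : ℝ}

lemma AttributedGraph.sum_weight_le {E : Set ℝ} {W : ℝ} (hE : ∀ e ∈ E, 0 < e ∧ e ≤ W)
    (G : AttributedGraph p₀ r E) (u : G.V) :
    ∑ v : G.Nbr u, (G.w u v : ℝ) / (W * Fintype.card G.V) ≤ 1 := by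
  obtain ⟨v₀⟩ : Nonempty (G.Nbr u) := inferInstance
  have hW : 0 < W := (hE _ (G.w u v₀).2).1.trans_le (hE _ (G.w u v₀).2).2
  have hV : (0 : ℝ) < Fintype.card G.V := by exact_mod_cast Fintype.card_pos_iff.2 ⟨u⟩
  rw [← Finset.sum_div, div_le_one (by positivity)]
  have h1 : ∑ v : G.Nbr u, (G.w u v : ℝ) ≤ ∑ _v : G.Nbr u, W :=
    Finset.sum_le_sum fun v _ => (hE _ (G.w u v).2).2
  have h2 : (Fintype.card (G.Nbr u) : ℝ) ≤ Fintype.card G.V := by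
    exact_mod_cast Fintype.card_le_of_injective _ Subtype.val_injective
  simp only [Finset.sum_const, Finset.card_univ, nsmul_eq_mul] at h1
  nlinarith

lemma AttributedGraph.deg_pos {E : Set ℝ} (hE : ∀ e ∈ E, 0 < e)
    (G : AttributedGraph p₀ r E) (u : G.V) : 0 < G.deg u :=
  Finset.sum_pos (fun v _ => hE _ (G.w u v).2) Finset.univ_nonempty

/-- The normalized-sum induced iterated degree measure. The edge weights in `E ⊆ (0, W]` are
rescaled to `(0, 1]` by dividing by `W`, so that
`μ_u = |V(G)|⁻¹ ∑_{v ∈ N(u)} (w_{uv} / W) δ_{η_v}` has mass at most one;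
if `E ⊆ (0, 1]`, take `W = 1`. -/
def sumIDM {E : Set ℝ} {W : ℝ} (hE : ∀ e ∈ E, 0 < e ∧ e ≤ W) (G : AttributedGraph p₀ r E) :
    ∀ t, G.V → IDM p₀ r t
  | 0, u => G.attr u
  | t + 1, u => WithLp.toLp 1 (sumIDM hE G t u,
      SubProb.weightedDirac (fun v : G.Nbr u => (G.w u v : ℝ) / (W * Fintype.card G.V))
        (fun v => div_nonneg (hE _ (G.w u v).2).1.le (mul_nonneg
          ((hE _ (G.w u v).2).1.le.trans (hE _ (G.w u v).2).2) (Nat.cast_nonneg _)))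
        (G.sum_weight_le hE u) (fun v => sumIDM hE G t v))

/-- The mean induced iterated degree measure, with
`π_u = deg(u)⁻¹ ∑_{v ∈ N(u)} w_{uv} δ_{η_v}`. -/
def meanIDM {E : Set ℝ} (hE : ∀ e ∈ E, 0 < e) (G : AttributedGraph p₀ r E) :
    ∀ t, G.V → IDM p₀ r t
  | 0, u => G.attr u
  | t + 1, u => WithLp.toLp 1 (meanIDM hE G t u,
      SubProb.weightedDirac (fun v : G.Nbr u => (G.w u v : ℝ) / G.deg u)
        (fun v => div_nonneg (hE _ (G.w u v).2).le (G.deg_pos hE u).le)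
        (by rw [← Finset.sum_div]; exact (div_self (G.deg_pos hE u).ne').le)
        (fun v => meanIDM hE G t v))

/-- The induced iterated neighborhood set, with `A_u = {(η_v, w_{uv}) : v ∈ N(u)}`. -/
def inducedINS {F : Type} [NormedAddCommGroup F] {E : Set F} (G : AttributedGraph p₀ r E) :
    ∀ t, G.V → INS p₀ r E t
  | 0, u => G.attr u
  | t + 1, u => WithLp.toLp 1 (inducedINS G t u,
      ⟨⟨Set.range fun v : G.Nbr u => WithLp.toLp 1 (inducedINS G t v, G.w u v),
        (Set.finite_range _).isCompact⟩, Set.range_nonempty _⟩)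

/-- The normalized-sum pseudo-metric `d_{sum,L}` on rooted graphs. -/
abbrev sumPseudoMetric {E : Set ℝ} {W : ℝ} (hE : ∀ e ∈ E, 0 < e ∧ e ≤ W) (L : ℕ) :
    PseudoMetricSpace (RootedGraph p₀ r E) :=
  PseudoMetricSpace.induced (fun x => sumIDM hE x.1 L x.2) inferInstance

/-- The mean-aggregation pseudo-metric `d_{mean,L}` on rooted graphs. -/
abbrev meanPseudoMetric {E : Set ℝ} (hE : ∀ e ∈ E, 0 < e) (L : ℕ) :
    PseudoMetricSpace (RootedGraph p₀ r E) :=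
  PseudoMetricSpace.induced (fun x => meanIDM hE x.1 L x.2) inferInstance

/-- The max-aggregation pseudo-metric `d_{max,L}` on rooted graphs. -/
abbrev maxPseudoMetric {F : Type} [NormedAddCommGroup F] (E : Set F) (L : ℕ) :
    PseudoMetricSpace (RootedGraph p₀ r E) :=
  PseudoMetricSpace.induced (fun x => inducedINS x.1 L x.2) inferInstance

end Induced

end

/-! Each pseudo-metric is pulled back from a representation space, so two facts suffice: that space
is compact, and the features of every network are Lipschitz in the representation. Total boundedness
passes to the pullback and gives finite covering numbers (`IsFiniteLipschitzClass.of_induced`).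

Compactness goes by induction on the layer. For degree measures, the sub-probability measures on a
compact space are weakly compact, and by Arzelà–Ascoli the Kantorovich–Rubinshtein distance is
weakly continuous there (`SubProb.compactSpace`). For neighborhood sets, the nonempty compact
subsets of a compact metric space form a compact space.

The Lipschitz bound is also an induction. Sum and mean aggregation are integrals of the previous
feature map against the measure component. That map is Lipschitz and, by compactness, bounded, hence
a multiple of a test function in each coordinate (`SubProb.norm_integral_sub_le`). For max and min,
the Hausdorff distance matches each neighbor on either side with a close one on the other, and
coordinatewise extrema are stable under such matchings (`norm_coordMax_sub_le`). This estimate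
compares graphs directly, so no feature map on arbitrary compact sets is needed. -/

/-! ### Compactness of the space of sub-probability measures -/

namespace KRTest

variable {X : Type} [MetricSpace X]

/-- Test functions as bounded continuous functions. -/
noncomputable def toBCF (f : KRTest X) : BoundedContinuousFunction X ℝ :=
  BoundedContinuousFunction.ofNormedAddCommGroup f.1
    (LipschitzWith.of_dist_le_mul (K := 1) fun x y => by
      simpa [Real.dist_eq] using f.2.1 x y).continuous 1 (fun x => by simpa using f.2.2 x)

/-- Arzelà–Ascoli: test functions share the bound and the Lipschitz constant 1. A finite net then
replaces the supremum in the distance. -/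
lemma totallyBounded_range_toBCF [CompactSpace X] :
    TotallyBounded (Set.range (toBCF : KRTest X → BoundedContinuousFunction X ℝ)) := by
  refine (IsCompact.totallyBounded (BoundedContinuousFunction.arzela_ascoli (Set.Icc (-1 : ℝ) 1)
    isCompact_Icc _ ?_ ?_)).subset subset_closure
  · rintro _ x ⟨f, rfl⟩
    exact abs_le.1 (f.2.2 x)
  · refine (LipschitzWith.uniformEquicontinuous _ 1 ?_).equicontinuous
    rintro ⟨_, f, rfl⟩
    exact LipschitzWith.of_dist_le_mul fun x y => by
      simpa [Real.dist_eq] using! f.2.1 x y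

end KRTest

namespace SubProb

variable {X : Type} [MetricSpace X] [MeasurableSpace X] [BorelSpace X]

lemma abs_integral_sub_le_dist (μ : SubProb X) (f g : BoundedContinuousFunction X ℝ) :
    |∫ x, f x ∂μ.1 - ∫ x, g x ∂μ.1| ≤ dist f g := by
  rw [← integral_sub (f.integrable μ.1) (g.integrable μ.1), ← Real.norm_eq_abs]
  refine (norm_integral_le_of_norm_le_const (C := dist f g)
    (Filter.Eventually.of_forall fun x => ?_)).trans ?_
  · rw [← dist_eq_norm]
    exact BoundedContinuousFunction.dist_coe_le_dist x
  · refine mul_le_of_le_one_right dist_nonneg ?_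
    simpa [Measure.real] using ENNReal.toReal_mono ENNReal.one_ne_top μ.2

/-- Finite measures of mass at most one as sub-probability measures. -/
def ofFiniteMeasure (μ : {μ : FiniteMeasure X // μ.mass ≤ 1}) : SubProb X :=
  ⟨μ.1, by rw [← FiniteMeasure.ennreal_mass]; exact_mod_cast μ.2⟩

/-- On a compact space, weak convergence of finite measures implies convergence for the
Kantorovich–Rubinshtein distance. -/
lemma continuous_ofFiniteMeasure [CompactSpace X] :
    Continuous (ofFiniteMeasure (X := X)) := by
  refine continuous_iff_continuousAt.2 fun μ => ?_
  rw [ContinuousAt, Metric.tendsto_nhds]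
  intro ε hε
  obtain ⟨t, ht, hcov⟩ := Metric.totallyBounded_iff.1 (KRTest.totallyBounded_range_toBCF (X := X))
    (ε / 4) (by positivity)
  have hw := FiniteMeasure.tendsto_iff_forall_integral_tendsto.1
    (continuous_subtype_val.tendsto μ)
  have hev : ∀ᶠ ν : {μ : FiniteMeasure X // μ.mass ≤ 1} in nhds μ, ∀ g ∈ t,
      |∫ x, g x ∂(ν.1 : Measure X) - ∫ x, g x ∂(μ.1 : Measure X)| < ε / 4 := by
    refine (Filter.eventually_all_finite ht).2 fun g _ => ?_
    simpa [Real.dist_eq] using Metric.tendsto_nhds.1 (hw g) (ε / 4) (by positivity)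
  filter_upwards [hev] with ν hν
  -- Three errors of size `ε / 4`: replacing `f` by a net element `g` under `ν`, moving from `ν` to
  -- `μ` for `g`, and returning to `f` under `μ`. The spare quarter keeps the inequality strict
  -- after the supremum.
  refine lt_of_le_of_lt (b := 3 * (ε / 4)) (ciSup_le fun f : KRTest X => ?_) (by linarith)
  obtain ⟨g, hg, hfg⟩ := Set.mem_iUnion₂.1 (hcov ⟨f, rfl⟩)
  have h1 := abs_integral_sub_le_dist (ofFiniteMeasure ν) f.toBCF g
  have h2 := abs_integral_sub_le_dist (ofFiniteMeasure μ) f.toBCF g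
  have h3 := hν g hg
  have h4 := Metric.mem_ball.1 hfg
  rw [abs_le] at h1 h2
  rw [abs_lt] at h3
  simp only [KRTest.toBCF, BoundedContinuousFunction.coe_ofNormedAddCommGroup,
    ofFiniteMeasure] at h1 h2 h4 ⊢
  rw [abs_le]
  constructor <;> linarith [h1.1, h1.2, h2.1, h2.2, h3.1, h3.2]

/-- A continuous image of a weakly compact set; only this direction of the comparison of topologies
is needed. -/
instance compactSpace [CompactSpace X] : CompactSpace (SubProb X) := by
  have hc : CompactSpace {μ : FiniteMeasure X // μ.mass ≤ 1} :=
    isCompact_iff_compactSpace.1 (isCompact_setOfPred_finiteMeasure_le_of_compactSpace X 1)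
  have := isCompact_range (continuous_ofFiniteMeasure (X := X))
  rw [Set.range_eq_univ.2] at this
  · exact ⟨this⟩
  · intro μ
    refine ⟨⟨⟨μ.1, inferInstance⟩, ?_⟩, rfl⟩
    exact ENNReal.coe_le_coe.1 ((FiniteMeasure.ennreal_mass (μ := ⟨μ.1, _⟩)).trans_le μ.2)

end SubProb

instance IDM.compactSpace (p₀ : ℕ) (r : ℝ) : ∀ t, CompactSpace (IDM p₀ r t)
  | 0 => isCompact_iff_compactSpace.1 (isCompact_closedBall _ _)
  | t + 1 => by
    have := IDM.compactSpace p₀ r t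
    exact (WithLp.homeomorphProd 1 (IDM p₀ r t) (SubProb (IDM p₀ r t))).symm.compactSpace

lemma INS.compactSpace (p₀ : ℕ) (r : ℝ) {F : Type} [NormedAddCommGroup F] {E : Set F}
    (hE : IsCompact E) : ∀ t, CompactSpace (INS p₀ r E t)
  | 0 => isCompact_iff_compactSpace.1 (isCompact_closedBall _ _)
  | t + 1 => by
    have := INS.compactSpace p₀ r hE t
    have := isCompact_iff_compactSpace.1 hE
    have : CompactSpace (WithLp 1 (INS p₀ r E t × E)) :=
      (WithLp.homeomorphProd 1 (INS p₀ r E t) E).symm.compactSpace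
    exact (WithLp.homeomorphProd 1 (INS p₀ r E t)
      (TopologicalSpace.NonemptyCompacts (WithLp 1 (INS p₀ r E t × E)))).symm.compactSpace

/-! ### Coordinatewise estimates -/

/-- The triangle inequality gives `n` instead of the sharp `√n`; only finiteness of the Lipschitz
constants matters. -/
lemma EuclideanSpace.norm_le_of_forall_abs_le {n : ℕ} {x : EuclideanSpace ℝ (Fin n)} {δ : ℝ}
    (h : ∀ i, |x i| ≤ δ) : ‖x‖ ≤ n * δ := by
  calc ‖x‖ = ‖∑ i, EuclideanSpace.single i (x i)‖ := by
        congr 1; ext j; simp [Finset.sum_apply, Pi.single_apply]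
    _ ≤ ∑ i, ‖EuclideanSpace.single i (x i)‖ := norm_sum_le _ _
    _ ≤ ∑ _i : Fin n, δ := Finset.sum_le_sum fun i _ => by simpa using h i
    _ = n * δ := by simp

lemma EuclideanSpace.abs_apply_le_norm {n : ℕ} (x : EuclideanSpace ℝ (Fin n)) (i : Fin n) :
    |x i| ≤ ‖x‖ := by
  simpa using PiLp.norm_apply_le x i

section CoordMax

variable {ι κ : Type} [Fintype ι] [Nonempty ι] [Fintype κ] [Nonempty κ] {n : ℕ}

/-- A one-sided matching, not necessarily injective, already bounds one maximum by the other, so the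
neighborhoods may differ in size. -/
lemma coordMax_apply_le {x : ι → EuclideanSpace ℝ (Fin n)} {y : κ → EuclideanSpace ℝ (Fin n)}
    {δ : ℝ} (h : ∀ i, ∃ j, ‖x i - y j‖ ≤ δ) (k : Fin n) :
    coordMax x k ≤ coordMax y k + δ := by
  refine Finset.sup'_le Finset.univ_nonempty (fun i => x i k) fun i _ => ?_
  obtain ⟨j, hj⟩ := h i
  have h1 := (abs_le.1 ((EuclideanSpace.abs_apply_le_norm _ k).trans hj)).2
  have h2 : y j k ≤ coordMax y k :=
    Finset.le_sup' (fun j => y j k) (Finset.mem_univ j)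
  simp only [PiLp.sub_apply] at h1
  linarith

lemma norm_coordMax_sub_le {x : ι → EuclideanSpace ℝ (Fin n)}
    {y : κ → EuclideanSpace ℝ (Fin n)} {δ : ℝ} (h : ∀ i, ∃ j, ‖x i - y j‖ ≤ δ)
    (h' : ∀ j, ∃ i, ‖x i - y j‖ ≤ δ) : ‖coordMax x - coordMax y‖ ≤ n * δ := by
  refine EuclideanSpace.norm_le_of_forall_abs_le fun k => ?_
  have h1 := coordMax_apply_le h k
  have h2 := coordMax_apply_le (x := y) (y := x) (δ := δ)
    (fun j => by simpa only [norm_sub_rev] using h' j) k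
  rw [PiLp.sub_apply, abs_le]
  constructor <;> linarith

lemma coordMin_eq_neg_coordMax (x : ι → EuclideanSpace ℝ (Fin n)) :
    coordMin x = -coordMax fun i => -x i := by
  ext k
  simp only [coordMin, coordMax, PiLp.neg_apply]
  refine le_antisymm ?_ ?_
  · rw [le_neg]
    refine Finset.sup'_le _ _ fun i _ => neg_le_neg ?_
    exact Finset.inf'_le (fun j => x j k) (Finset.mem_univ i)
  · refine Finset.le_inf' _ _ fun i _ => ?_
    rw [neg_le]
    exact Finset.le_sup' (fun j => -x j k) (Finset.mem_univ i)

lemma norm_coordMin_sub_le {x : ι → EuclideanSpace ℝ (Fin n)}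
    {y : κ → EuclideanSpace ℝ (Fin n)} {δ : ℝ} (h : ∀ i, ∃ j, ‖x i - y j‖ ≤ δ)
    (h' : ∀ j, ∃ i, ‖x i - y j‖ ≤ δ) : ‖coordMin x - coordMin y‖ ≤ n * δ := by
  rw [coordMin_eq_neg_coordMax, coordMin_eq_neg_coordMax, neg_sub_neg, norm_sub_rev]
  have aux : ∀ i j, ‖-x i - -y j‖ = ‖x i - y j‖ := fun i j => by
    rw [neg_sub_neg, norm_sub_rev]
  exact norm_coordMax_sub_le (by simpa only [aux] using h) (by simpa only [aux] using h')

end CoordMax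

lemma dist_eq_add_of_withLp_one {α β : Type*} [PseudoMetricSpace α] [PseudoMetricSpace β]
    (x y : WithLp 1 (α × β)) : dist x y = dist x.fst y.fst + dist x.snd y.snd := by
  rw [WithLp.prod_dist_eq_add (by simp)]
  simp

/-! ### Features as Lipschitz functions of iterated degree measures -/

lemma SubProb.norm_integral_sub_le {X : Type} [MetricSpace X] [MeasurableSpace X] [BorelSpace X]
    [CompactSpace X] {n : ℕ} {g : X → EuclideanSpace ℝ (Fin n)} {K : ℝ≥0}
    (hg : LipschitzWith K g) :
    ∃ C : ℝ, 0 ≤ C ∧ ∀ μ ν : SubProb X,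
      ‖∫ x, g x ∂μ.1 - ∫ x, g x ∂ν.1‖ ≤ C * dist μ ν := by
  obtain ⟨B, hB⟩ := (isCompact_range hg.continuous).isBounded.exists_norm_le
  -- Dividing a coordinate of `g` by `c` makes it 1-Lipschitz and bounded by 1; the outer maximum
  -- keeps `c` positive.
  let c : ℝ := max (max K B) 1
  have hc : 0 < c := lt_max_of_lt_right one_pos
  refine ⟨n * c, by positivity, fun μ ν => ?_⟩
  have hint : ∀ μ : SubProb X, Integrable g μ.1 := fun μ =>
    (BoundedContinuousFunction.mkOfCompact ⟨g, hg.continuous⟩).integrable μ.1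
  have hcoord : ∀ (μ : SubProb X) (i : Fin n), (∫ x, g x ∂μ.1) i = ∫ x, g x i ∂μ.1 := fun μ i =>
    ((EuclideanSpace.proj (𝕜 := ℝ) i).integral_comp_comm (hint μ)).symm
  rw [mul_assoc]
  refine EuclideanSpace.norm_le_of_forall_abs_le fun i => ?_
  let f : KRTest X := ⟨fun x => c⁻¹ * g x i, fun x x' => by
      rw [← mul_sub, abs_mul, abs_of_pos (inv_pos.2 hc), inv_mul_le_iff₀ hc]
      calc |g x i - g x' i| ≤ ‖g x - g x'‖ := EuclideanSpace.abs_apply_le_norm (g x - g x') i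
        _ ≤ K * dist x x' := by rw [← dist_eq_norm]; exact hg.dist_le_mul x x'
        _ ≤ c * dist x x' := by
          gcongr; exact (le_max_left _ _).trans (le_max_left _ _), fun x => by
      rw [abs_mul, abs_of_pos (inv_pos.2 hc), inv_mul_le_iff₀ hc, mul_one]
      exact (EuclideanSpace.abs_apply_le_norm _ i).trans ((hB _ ⟨x, rfl⟩).trans
        ((le_max_right _ _).trans (le_max_left _ _)))⟩
  have h := SubProb.le_krDist μ ν f
  simp only [f, integral_const_mul] at h
  rw [← mul_sub, abs_mul, abs_of_pos (inv_pos.2 hc), inv_mul_le_iff₀ hc] at h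
  rw [PiLp.sub_apply, hcoord, hcoord]
  exact h

lemma SubProb.integral_weightedDirac {X : Type} [MeasurableSpace X] [MeasurableSingletonClass X]
    {ι : Type} [Fintype ι] {c : ι → ℝ} (hc : ∀ j, 0 ≤ c j) (hsum : ∑ j, c j ≤ 1) (x : ι → X)
    {n : ℕ} (g : X → EuclideanSpace ℝ (Fin n)) :
    ∫ y, g y ∂(SubProb.weightedDirac c hc hsum x).1 = ∑ j, c j • g (x j) := by
  have hint : ∀ j ∈ Finset.univ, Integrable g (ENNReal.ofReal (c j) • Measure.dirac (x j)) :=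
    fun j _ => (integrable_dirac (by simp)).smul_measure ENNReal.ofReal_ne_top
  simp only [weightedDirac]
  rw [integral_finsetSum_measure hint]
  exact Finset.sum_congr rfl fun j _ => by
    rw [integral_smul_measure, integral_dirac, ENNReal.toReal_ofReal (hc j)]

section IDMFeature

variable {p : ℕ → ℕ} {r : ℝ}

/-- The feature map on iterated degree measures, with messages scaled by `W`. -/
noncomputable def idmFeature (φ : UpdateMaps p) (W : ℝ) :
    ∀ t, IDM (p 0) r t → EuclideanSpace ℝ (Fin (p t))
  | 0, x => (show Metric.closedBall (0 : EuclideanSpace ℝ (Fin (p 0))) r from x).1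
  | t + 1, x =>
    let y : WithLp 1 (IDM (p 0) r t × SubProb (IDM (p 0) r t)) := x
    φ t (idmFeature φ W t y.fst) (W • ∫ z, idmFeature φ W t z ∂y.snd.1)

lemma lipschitzWith_idmFeature {φ : UpdateMaps p} (W : ℝ) {L : ℕ}
    (hφ : ∀ t < L, IsLipschitzInPair (φ t)) :
    ∀ t ≤ L, ∃ K : ℝ≥0, LipschitzWith K (idmFeature (r := r) φ W t)
  | 0, _ => ⟨1, LipschitzWith.subtype_val _⟩
  | t + 1, ht => by
    obtain ⟨K, hK⟩ := lipschitzWith_idmFeature W hφ t (Nat.le_of_succ_le ht)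
    obtain ⟨C₁, C₂, h₁, h₂, h⟩ := hφ t ht
    obtain ⟨C, hC, hint⟩ := SubProb.norm_integral_sub_le hK
    -- The sum of the coefficients of the two components, so it dominates each.
    let D : ℝ := C₁ * K + C₂ * (|W| * C)
    have hD : 0 ≤ D := by positivity
    refine ⟨D.toNNReal, LipschitzWith.of_dist_le_mul ?_⟩
    intro (x : WithLp 1 (IDM (p 0) r t × SubProb (IDM (p 0) r t)))
      (y : WithLp 1 (IDM (p 0) r t × SubProb (IDM (p 0) r t)))
    rw [Real.coe_toNNReal _ hD]
    change _ ≤ D * dist x y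
    rw [dist_eq_add_of_withLp_one, dist_eq_norm]
    have e1 : ‖idmFeature φ W t x.fst - idmFeature φ W t y.fst‖ ≤ K * dist x.fst y.fst := by
      rw [← dist_eq_norm]; exact hK.dist_le_mul _ _
    have e2 : ‖W • ∫ z, idmFeature φ W t z ∂x.snd.1 - W • ∫ z, idmFeature φ W t z ∂y.snd.1‖
        ≤ |W| * (C * dist x.snd y.snd) := by
      rw [← smul_sub, norm_smul, Real.norm_eq_abs]
      gcongr
      exact hint _ _
    refine (h _ _ _ _).trans ?_
    calc _ ≤ C₁ * (K * dist x.fst y.fst) + C₂ * (|W| * (C * dist x.snd y.snd)) := by gcongr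
      _ = (C₁ * K) * dist x.fst y.fst + (C₂ * (|W| * C)) * dist x.snd y.snd := by ring
      _ ≤ D * dist x.fst y.fst + D * dist x.snd y.snd := by
        have := h₁.le
        have := h₂.le
        gcongr
        · exact le_add_of_nonneg_right (by positivity)
        · exact le_add_of_nonneg_left (by positivity)
      _ = D * (dist x.fst y.fst + dist x.snd y.snd) := by ring

/-- The factor `W` in the feature map undoes the rescaling of the edge weights by `W`. -/
lemma idmFeature_sumIDM (φ : UpdateMaps p) {E : Set ℝ} {W : ℝ}
    (hE : ∀ e ∈ E, 0 < e ∧ e ≤ W) (G : AttributedGraph (p 0) r E) :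
    ∀ t u, idmFeature φ W t (sumIDM hE G t u) = sumFeature φ G t u
  | 0, _ => rfl
  | t + 1, u => by
    obtain ⟨v₀⟩ : Nonempty (G.Nbr u) := inferInstance
    -- Any incident edge forces `W > 0`, and one exists because no vertex is isolated.
    have hW : W ≠ 0 := ((hE _ (G.w u v₀).2).1.trans_le (hE _ (G.w u v₀).2).2).ne'
    simp only [idmFeature, sumIDM, sumFeature]
    congr 1
    · exact idmFeature_sumIDM φ hE G t u
    · refine (congrArg (W • ·) (SubProb.integral_weightedDirac
        (fun v => div_nonneg (hE _ (G.w u v).2).1.le (mul_nonneg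
          ((hE _ (G.w u v).2).1.le.trans (hE _ (G.w u v).2).2) (Nat.cast_nonneg _)))
        (G.sum_weight_le hE u) _ _)).trans ?_
      rw [Finset.smul_sum, Finset.smul_sum]
      refine Finset.sum_congr rfl fun v _ => ?_
      rw [idmFeature_sumIDM φ hE G t, smul_smul, smul_smul]
      congr 1
      field_simp

lemma idmFeature_meanIDM (φ : UpdateMaps p) {E : Set ℝ}
    (hE : ∀ e ∈ E, 0 < e) (G : AttributedGraph (p 0) r E) :
    ∀ t u, idmFeature φ 1 t (meanIDM hE G t u) = meanFeature φ G t u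
  | 0, _ => rfl
  | t + 1, u => by
    simp only [idmFeature, meanIDM, meanFeature]
    congr 1
    · exact idmFeature_meanIDM φ hE G t u
    · refine (congrArg ((1 : ℝ) • ·) (SubProb.integral_weightedDirac
        (fun v => div_nonneg (hE _ (G.w u v).2).le (G.deg_pos hE u).le)
        (by rw [← Finset.sum_div]; exact (div_self (G.deg_pos hE u).ne').le) _ _)).trans ?_
      rw [one_smul, Finset.smul_sum]
      refine Finset.sum_congr rfl fun v _ => ?_
      rw [idmFeature_meanIDM φ hE G t, smul_smul, div_eq_inv_mul]

end IDMFeature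

/-! ### Lipschitz estimates on iterated neighborhood sets -/

section INSFeature

open TopologicalSpace

/-- Every point of a compact set is within Hausdorff distance of the other set. -/
lemma TopologicalSpace.NonemptyCompacts.exists_dist_le {X : Type*} [MetricSpace X]
    (A B : NonemptyCompacts X) {x : X} (hx : x ∈ A) : ∃ y ∈ B, dist x y ≤ dist A B := by
  obtain ⟨y, hy, h⟩ := B.isCompact.exists_infDist_eq_dist B.nonempty x
  refine ⟨y, hy, ?_⟩
  rw [← h, Metric.NonemptyCompacts.dist_eq]
  exact Metric.infDist_le_hausdorffDist_of_mem hx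
    (Metric.hausdorffEDist_ne_top_of_nonempty_of_bounded A.nonempty B.nonempty
      A.isCompact.isBounded B.isCompact.isBounded)

variable {p : ℕ → ℕ} {r : ℝ} {F : Type} [NormedAddCommGroup F] {E : Set F}

/-- A layered feature map whose aggregations are Lipschitz for matchings of the messages is
Lipschitz in the induced iterated neighborhood sets. -/
lemma exists_lipschitz_of_aggregation {φ : UpdateMaps p} {M : MessageMaps p F} {L : ℕ}
    (hφ : ∀ t < L, IsLipschitzInPair (φ t)) (hM : ∀ t < L, IsLipschitzInPair (M t))
    (agg : ∀ {ι : Type} [Fintype ι] [Nonempty ι] {n : ℕ},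
      (ι → EuclideanSpace ℝ (Fin n)) → EuclideanSpace ℝ (Fin n))
    (hagg : ∀ {ι κ : Type} [Fintype ι] [Nonempty ι] [Fintype κ] [Nonempty κ] {n : ℕ}
      {x : ι → EuclideanSpace ℝ (Fin n)} {y : κ → EuclideanSpace ℝ (Fin n)} {δ : ℝ},
      (∀ i, ∃ j, ‖x i - y j‖ ≤ δ) → (∀ j, ∃ i, ‖x i - y j‖ ≤ δ) →
        ‖agg x - agg y‖ ≤ n * δ)
    (h : ∀ (G : AttributedGraph (p 0) r E) (t : ℕ), G.V → EuclideanSpace ℝ (Fin (p t)))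
    (h_zero : ∀ G u, h G 0 u = (G.attr u : EuclideanSpace ℝ (Fin (p 0))))
    (h_succ : ∀ G t u, h G (t + 1) u =
      φ t (h G t u) (agg fun v : G.Nbr u => M t (h G t v) (G.w u v))) :
    ∀ t ≤ L, ∃ K : ℝ≥0, ∀ (G G' : AttributedGraph (p 0) r E) (u : G.V) (u' : G'.V),
      dist (h G t u) (h G' t u') ≤ K * dist (inducedINS G t u) (inducedINS G' t u')
  | 0, _ => ⟨1, fun G G' u u' => by
      rw [h_zero, h_zero, NNReal.coe_one, one_mul]
      exact le_refl _⟩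
  | t + 1, ht => by
    obtain ⟨K, hK⟩ := exists_lipschitz_of_aggregation hφ hM agg hagg h h_zero h_succ t
      (Nat.le_of_succ_le ht)
    obtain ⟨C₁, C₂, h₁, h₂, hφt⟩ := hφ t ht
    obtain ⟨D₁, D₂, k₁, k₂, hMt⟩ := hM t ht
    let D : ℝ := D₁ * K + D₂
    have hD : 0 ≤ D := by positivity
    let C : ℝ := C₁ * K + C₂ * (p t * D)
    have hC : 0 ≤ C := by positivity
    refine ⟨C.toNNReal, fun G G' u u' => ?_⟩
    rw [Real.coe_toNNReal _ hC]
    -- The set component of the next representation, named so that `hdist` holds by unfolding.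
    let N : ∀ (G : AttributedGraph (p 0) r E) (u : G.V),
        NonemptyCompacts (WithLp 1 (INS (p 0) r E t × E)) := fun G u =>
      ⟨⟨Set.range fun v : G.Nbr u => WithLp.toLp 1 (inducedINS G t v, G.w u v),
        (Set.finite_range _).isCompact⟩, Set.range_nonempty _⟩
    have hdist : dist (inducedINS G (t + 1) u) (inducedINS G' (t + 1) u') =
        dist (inducedINS G t u) (inducedINS G' t u') + dist (N G u) (N G' u') :=
      dist_eq_add_of_withLp_one (α := INS (p 0) r E t)
        (β := NonemptyCompacts (WithLp 1 (INS (p 0) r E t × E)))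
        (WithLp.toLp 1 (inducedINS G t u, N G u)) (WithLp.toLp 1 (inducedINS G' t u', N G' u'))
    have hmsg : ∀ (v : G.Nbr u) (v' : G'.Nbr u'),
        dist (WithLp.toLp 1 (inducedINS G t v, G.w u v))
          (WithLp.toLp 1 (inducedINS G' t v', G'.w u' v')) ≤ dist (N G u) (N G' u') →
        ‖M t (h G t v) (G.w u v) - M t (h G' t v') (G'.w u' v')‖ ≤
          D * dist (N G u) (N G' u') := by
      intro v v' hv
      rw [dist_eq_add_of_withLp_one] at hv
      have e1 := hK G G' v v'
      rw [dist_eq_norm] at e1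
      refine (hMt _ _ _ _).trans ?_
      have e2 : ‖(G.w u v : F) - G'.w u' v'‖ = dist (G.w u v) (G'.w u' v') := by
        rw [Subtype.dist_eq, dist_eq_norm]
      rw [e2]
      have f1 : dist (inducedINS G t v) (inducedINS G' t v') ≤ dist (N G u) (N G' u') :=
        (le_add_of_nonneg_right dist_nonneg).trans hv
      have f2 : dist (G.w u v) (G'.w u' v') ≤ dist (N G u) (N G' u') :=
        (le_add_of_nonneg_left dist_nonneg).trans hv
      calc _ ≤ D₁ * (K * dist (inducedINS G t v) (inducedINS G' t v')) +
            D₂ * dist (G.w u v) (G'.w u' v') := by gcongr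
        _ ≤ D₁ * (K * dist (N G u) (N G' u')) + D₂ * dist (N G u) (N G' u') := by gcongr
        _ = D * dist (N G u) (N G' u') := by ring
    have hA := hagg (x := fun v : G.Nbr u => M t (h G t v) (G.w u v))
      (y := fun v : G'.Nbr u' => M t (h G' t v) (G'.w u' v)) (δ := D * dist (N G u) (N G' u'))
      (fun v => by
        obtain ⟨_, ⟨v', rfl⟩, hv⟩ := (N G u).exists_dist_le (N G' u') ⟨v, rfl⟩
        exact ⟨v', hmsg v v' hv⟩)
      (fun v' => by
        -- The same matching with the graphs exchanged; symmetry of the distance restores the order.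
        obtain ⟨_, ⟨v, rfl⟩, hv⟩ := (N G' u').exists_dist_le (N G u) ⟨v', rfl⟩
        rw [dist_comm, dist_comm (N G' u')] at hv
        exact ⟨v, hmsg v v' hv⟩)
    have hU := hK G G' u u'
    rw [dist_eq_norm] at hU
    rw [hdist, h_succ, h_succ, dist_eq_norm]
    refine (hφt _ _ _ _).trans ?_
    calc _ ≤ C₁ * (K * dist (inducedINS G t u) (inducedINS G' t u')) +
          C₂ * (p t * (D * dist (N G u) (N G' u'))) := by gcongr
      _ = C₁ * K * dist (inducedINS G t u) (inducedINS G' t u') +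
          C₂ * (p t * D) * dist (N G u) (N G' u') := by ring
      _ ≤ C * dist (inducedINS G t u) (inducedINS G' t u') + C * dist (N G u) (N G' u') := by
        gcongr
        · exact le_add_of_nonneg_right (by positivity)
        · exact le_add_of_nonneg_left (by positivity)
      _ = C * (dist (inducedINS G t u) (inducedINS G' t u') + dist (N G u) (N G' u')) := by ring

end INSFeature

/-! ### Finite Lipschitz classes -/

lemma RootedGraph.nonempty {p₀ : ℕ} {r : ℝ} (hr : 0 ≤ r) {F : Type} {E : Set F}
    (hE : E.Nonempty) : Nonempty (RootedGraph p₀ r E) :=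
  ⟨⟨{ V := Bool
      graph := ⊤
      attr := fun _ => ⟨0, Metric.mem_closedBall_self hr⟩
      edgeFeature := fun _ => ⟨hE.some, hE.some_mem⟩
      exists_adj := fun u => ⟨!u, by cases u <;> simp⟩ }, true⟩⟩

lemma IsFiniteLipschitzClass.of_induced {X Θ Y Z : Type*} [PseudoMetricSpace Y]
    [PseudoMetricSpace Z] [CompactSpace Z] [Nonempty X] (g : X → Z) (f : Θ → X → Y)
    (h : ∀ θ, ∃ K : ℝ≥0, ∀ x x', dist (f θ x) (f θ x') ≤ K * dist (g x) (g x')) :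
    IsFiniteLipschitzClass (PseudoMetricSpace.induced g inferInstance) f := by
  let d : PseudoMetricSpace X := PseudoMetricSpace.induced g inferInstance
  refine ⟨inferInstance, fun θ => ?_, fun ε hε => ?_⟩
  · obtain ⟨K, hK⟩ := h θ
    exact ⟨K, LipschitzWith.of_dist_le_mul hK⟩
  · have hg : IsUniformInducing g := ⟨rfl⟩
    -- The image of `g` need not be closed, but total boundedness pulls back and yields ball centres
    -- in `X` itself.
    have htb : TotallyBounded (Set.univ : Set X) :=
      totallyBounded_preimage hg (isCompact_univ (X := Z)).totallyBounded
    obtain ⟨N, hN, hfin, hcov⟩ := Metric.exists_finite_isCover_of_totallyBounded hε.ne' htb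
    exact (hcov.coveringNumber_le_encard hN).trans_lt (Set.encard_lt_top_iff.2 hfin)

theorem mainTheorem2 {Θ : Type*} (p : ℕ → ℕ) (r : ℝ) (hr : 0 < r) (L : ℕ)
    (φ : Θ → UpdateMaps p) (hφ : ∀ θ, ∀ t < L, IsLipschitzInPair (φ θ t)) :
    -- normalized-sum and mean aggregation, with positive edge weights
    (CompactSpace (IDM (p 0) r L) ∧
      ∀ (E : Set ℝ) (_ : E.Nonempty) (_ : IsCompact E),
        (∀ (W : ℝ) (hE : ∀ e ∈ E, 0 < e ∧ e ≤ W),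
          IsFiniteLipschitzClass (sumPseudoMetric hE L)
            (fun θ (x : RootedGraph (p 0) r E) => sumFeature (φ θ) x.1 L x.2)) ∧
        (∀ hE : ∀ e ∈ E, 0 < e,
          IsFiniteLipschitzClass (meanPseudoMetric hE L)
            (fun θ (x : RootedGraph (p 0) r E) => meanFeature (φ θ) x.1 L x.2))) ∧
    -- max and min aggregation, with edge features in a normed space
    (∀ (F : Type) [NormedAddCommGroup F] [NormedSpace ℝ F] (E : Set F)
        (_ : E.Nonempty) (_ : IsCompact E)
        (M : Θ → MessageMaps p F) (_ : ∀ θ, ∀ t < L, IsLipschitzInPair (M θ t)),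
      CompactSpace (INS (p 0) r E L) ∧
      IsFiniteLipschitzClass (maxPseudoMetric E L)
        (fun θ (x : RootedGraph (p 0) r E) => maxFeature (φ θ) (M θ) x.1 L x.2) ∧
      IsFiniteLipschitzClass (maxPseudoMetric E L)
        (fun θ (x : RootedGraph (p 0) r E) => minFeature (φ θ) (M θ) x.1 L x.2)) := by
  refine ⟨⟨inferInstance, fun E hne _ => ⟨fun W hE => ?_, fun hE => ?_⟩⟩, ?_⟩
  · have := RootedGraph.nonempty (p₀ := p 0) hr.le hne
    refine IsFiniteLipschitzClass.of_induced _ _ fun θ => ?_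
    obtain ⟨K, hK⟩ := lipschitzWith_idmFeature (r := r) W (hφ θ) L le_rfl
    refine ⟨K, fun x x' => ?_⟩
    have := hK.dist_le_mul (sumIDM hE x.1 L x.2) (sumIDM hE x'.1 L x'.2)
    rwa [idmFeature_sumIDM, idmFeature_sumIDM] at this
  · have := RootedGraph.nonempty (p₀ := p 0) hr.le hne
    refine IsFiniteLipschitzClass.of_induced _ _ fun θ => ?_
    -- Scale 1, because division by the degree already normalizes the mass.
    obtain ⟨K, hK⟩ := lipschitzWith_idmFeature (r := r) 1 (hφ θ) L le_rfl
    refine ⟨K, fun x x' => ?_⟩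
    have := hK.dist_le_mul (meanIDM hE x.1 L x.2) (meanIDM hE x'.1 L x'.2)
    rwa [idmFeature_meanIDM, idmFeature_meanIDM] at this
  · intro F _ _ E hne hEc M hM
    have := RootedGraph.nonempty (p₀ := p 0) hr.le hne
    have := INS.compactSpace (p 0) r hEc L
    refine ⟨this, ?_, ?_⟩
    · refine IsFiniteLipschitzClass.of_induced _ _ fun θ => ?_
      obtain ⟨K, hK⟩ := exists_lipschitz_of_aggregation (E := E) (hφ θ) (hM θ) coordMax
        norm_coordMax_sub_le (maxFeature (φ θ) (M θ)) (fun _ _ => rfl) (fun _ _ _ => rfl) L le_rfl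
      exact ⟨K, fun x x' => hK _ _ _ _⟩
    · refine IsFiniteLipschitzClass.of_induced _ _ fun θ => ?_
      obtain ⟨K, hK⟩ := exists_lipschitz_of_aggregation (E := E) (hφ θ) (hM θ) coordMin
        norm_coordMin_sub_le (minFeature (φ θ) (M θ)) (fun _ _ => rfl) (fun _ _ _ => rfl) L le_rfl
      exact ⟨K, fun x x' => hK _ _ _ _⟩
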